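/- Let $F$ be an algebraically closed field of characteristic $p>0$ and let $L$ be a finite-dimensional restricted Lie algebra over $F$, with $p$-map $x\mapsto x^{[p]}$. A restricted subalgebra of $L$ is a Lie subalgebra closed under the $p$-map; a maximal restricted subalgebra is a maximal element among the proper restricted subalgebras of $L$. Suppose that $L$ is dually atomistic, that is, every restricted subalgebra of $L$ is an intersection of maximal restricted subalgebras of $L$ (the intersection of the empty family being $L$). Then $L$ is solvable or semisimple, where semisimple means that the solvable radical of $L$ (its largest solvable ideal) is zero. -/

import Mathlib

/-- The coefficient of `X ^ k` in `(ad (X x + y)) ^ n (x)`, computed in `L ⊗ F[X]`. The recursion is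
`ad (X x + y) (∑ c k X ^ k) = ∑ (⁅y, c k⁆ + ⁅x, c (k - 1)⁆) X ^ k`. -/
def jacobsonCoeff {L : Type*} [LieRing L] (x y : L) : ℕ → ℕ → L
  | 0, 0 => x
  | 0, _ + 1 => 0
  | n + 1, 0 => ⁅y, jacobsonCoeff x y n 0⁆
  | n + 1, k + 1 => ⁅y, jacobsonCoeff x y n (k + 1)⁆ + ⁅x, jacobsonCoeff x y n k⁆

/-- Jacobson's element `s i (x, y)`, for `1 ≤ i ≤ p - 1`: `i` times it is the coefficient of
`X ^ (i - 1)` in `(ad (X x + y)) ^ (p - 1) (x)`. -/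
def jacobsonS (F : Type*) {L : Type*} [Field F] [LieRing L] [LieAlgebra F L]
    (p : ℕ) (x y : L) (i : ℕ) : L :=
  (i : F)⁻¹ • jacobsonCoeff x y (p - 1) (i - 1)

/-- A `p`-map on a Lie algebra `L` over a field `F` (of characteristic `p`). A restricted Lie
algebra is a Lie algebra together with such a map `x ↦ x^[p]`. -/
structure PMap (p : ℕ) (F L : Type*) [Field F] [LieRing L] [LieAlgebra F L] where
  toFun : L → L
  ad_toFun : ∀ x : L, LieAlgebra.ad F L (toFun x) = (LieAlgebra.ad F L x) ^ p
  toFun_smul : ∀ (a : F) (x : L), toFun (a • x) = a ^ p • toFun x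
  toFun_add : ∀ x y : L,
    toFun (x + y) = toFun x + toFun y + ∑ i ∈ Finset.Icc 1 (p - 1), jacobsonS F p x y i

namespace PMap

/-- A restricted subalgebra: a Lie subalgebra closed under the `p`-map. -/
def IsRestricted {p : ℕ} {F L : Type*} [Field F] [LieRing L] [LieAlgebra F L]
    (P : PMap p F L) (K : LieSubalgebra F L) : Prop :=
  ∀ x ∈ K, P.toFun x ∈ K

/-- A maximal restricted subalgebra: maximal among the proper restricted subalgebras. -/
def IsMaximalRestricted {p : ℕ} {F L : Type*} [Field F] [LieRing L] [LieAlgebra F L]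
    (P : PMap p F L) (M : LieSubalgebra F L) : Prop :=
  P.IsRestricted M ∧ M ≠ ⊤ ∧ ∀ K : LieSubalgebra F L, P.IsRestricted K → M < K → K = ⊤

/-- Every restricted subalgebra is an intersection of maximal restricted subalgebras (the whole
algebra being the intersection of the empty family). -/
def IsDuallyAtomistic {p : ℕ} {F L : Type*} [Field F] [LieRing L] [LieAlgebra F L]
    (P : PMap p F L) : Prop :=
  ∀ K : LieSubalgebra F L, P.IsRestricted K →
    ∃ S : Set (LieSubalgebra F L), (∀ M ∈ S, P.IsMaximalRestricted M) ∧ K = sInf S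

end PMap

/-! Dual atomisticity separates an element from a restricted subalgebra not containing it by a
maximal `M`. If `M` avoids a `p`-stable line `F a` that is an ideal, then `L = M + F a`, which
forces a derived term of `L` into `M`.

Eigenvector case, `a ≠ 0` with `F a` an ideal and `a^[p] = 0`: every such `M` contains the second
derived term. Testing the restricted subalgebra generated by `k + a`, for `k` in that term, shows
that `ad k` has the same kernel as its square. Eigenvectors of `ad k` for nonzero eigenvalues are
excluded in the same way, so `ad k = 0` and the third derived term vanishes.

Central toral case, `z^[p] = z ≠ 0`: every `M` avoiding `z` contains `[L, L]`. A toral `w ≠ 0`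
arising from `[L, L]` would contradict separation of `z` from `F (w + z)`, so `[L, L]` is
`p`-nilpotent and Engel's theorem applies.

A nonzero center yields one of the two cases. With zero center and nonzero radical, a nonzero
abelian ideal has zero `p`-map and all its lines are ideals, which is the eigenvector case. -/

theorem Module.End.eq_zero_of_ker_sq_of_eigenvectors {F V : Type*} [Field F] [IsAlgClosed F]
    [AddCommGroup V] [Module F V] [Module.Finite F V] (f : Module.End F V)
    (hker : ∀ v, f (f v) = 0 → f v = 0) (heig : ∀ (μ : F) (v : V), f v = μ • v → f v = 0) :
    f = 0 := by
  rw [← LinearMap.ker_eq_top, eq_top_iff, ← Module.End.iSup_maxGenEigenspace_eq_top f]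
  refine iSup_le fun μ v hv => ?_
  obtain ⟨k, hk⟩ := (Module.End.mem_maxGenEigenspace f μ v).1 hv
  induction k with
  | zero => simp_all
  | succ k ih =>
    rcases eq_or_ne μ 0 with rfl | hμ
    · have hpow : ∀ n, (f ^ (n + 1)) v = 0 → f v = 0 := by
        intro n
        induction n with
        | zero => simp
        | succ n ihn =>
          intro h
          apply ihn
          rw [pow_succ', Module.End.mul_apply]
          apply hker
          rwa [pow_succ', pow_succ', Module.End.mul_apply, Module.End.mul_apply] at h
      exact hpow k (by simpa using hk)
    · apply ih
      rw [pow_succ', Module.End.mul_apply] at hk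
      generalize ((f - μ • 1) ^ k) v = w at hk ⊢
      have hw : f w = μ • w := by simpa [sub_eq_zero] using hk
      have := heig μ w hw
      rw [hw] at this
      exact (smul_eq_zero.1 this).resolve_left hμ

/-! ### Polynomials for the fixed-vector equation of a semilinear map -/

/-- Coefficients of a fixed vector of a `p`-semilinear map: `y i` is the value at `t` of the
`i`-th polynomial, in the recursion `y 0 = c 0 t ^ p`, `y (i + 1) = y i ^ p + c (i + 1) t ^ p`. -/
noncomputable def semilinearPoly {F : Type*} [Field F] (p : ℕ) (c : ℕ → F) : ℕ → Polynomial F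
  | 0 => Polynomial.C (c 0) * Polynomial.X ^ p
  | i + 1 => semilinearPoly p c i ^ p + Polynomial.C (c (i + 1)) * Polynomial.X ^ p

theorem semilinearPoly_dvd {F : Type*} [Field F] {p : ℕ} (hp : 2 ≤ p) (c : ℕ → F) (i : ℕ) :
    Polynomial.X ^ 2 ∣ semilinearPoly p c i := by
  have hX : (Polynomial.X : Polynomial F) ^ 2 ∣ Polynomial.X ^ p := pow_dvd_pow _ hp
  induction i with
  | zero => exact hX.mul_left _
  | succ i ih => exact dvd_add (ih.trans (dvd_pow_self _ (by omega))) (hX.mul_left _)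

/-- This gives nonvanishing: after the first nonzero `c j`, the `p`-th power has degree at least `p
* p`, so the added term of degree at most `p` cannot cancel it. -/
theorem semilinearPoly_natDegree {F : Type*} [Field F] {p : ℕ} (hp : 2 ≤ p) (c : ℕ → F) (i : ℕ) :
    ((∀ j ≤ i, c j = 0) ∧ semilinearPoly p c i = 0) ∨ p ≤ (semilinearPoly p c i).natDegree := by
  induction i with
  | zero =>
    by_cases h : c 0 = 0
    · left; simp [semilinearPoly, h]
    · right; simp [semilinearPoly, Polynomial.natDegree_C_mul_X_pow _ _ h]
  | succ i ih =>
    rcases ih with ⟨h1, h2⟩ | h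
    · by_cases hc : c (i + 1) = 0
      · left
        refine ⟨fun j hj => ?_, by simp [semilinearPoly, h2, hc]; omega⟩
        rcases Nat.lt_or_ge i j with h | h
        · rwa [show j = i + 1 by omega]
        · exact h1 j h
      · right
        have h0 : p ≠ 0 := by omega
        simp [semilinearPoly, h2, h0, Polynomial.natDegree_C_mul_X_pow _ _ hc]
    · right
      have hlt : (Polynomial.C (c (i + 1)) * Polynomial.X ^ p).natDegree <
          (semilinearPoly p c i ^ p).natDegree := by
        rw [Polynomial.natDegree_pow]
        have := Polynomial.natDegree_C_mul_X_pow_le (c (i + 1)) p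
        nlinarith
      rw [semilinearPoly, Polynomial.natDegree_add_eq_left_of_natDegree_lt hlt,
        Polynomial.natDegree_pow]
      nlinarith

/-- Writing the polynomial as `X ^ 2 * G`, the nonzero fixed points are the roots of `X * G - 1`,
which is nonconstant once `G ≠ 0`. -/
theorem exists_semilinearPoly_eval_eq_self {F : Type*} [Field F] [IsAlgClosed F] {p : ℕ}
    (hp : 2 ≤ p) (c : ℕ → F) (m : ℕ) (hc : ∃ j ≤ m, c j ≠ 0) :
    ∃ t : F, t ≠ 0 ∧ (semilinearPoly p c m).eval t = t := by
  obtain ⟨G, hG⟩ := semilinearPoly_dvd hp c m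
  have hG0 : G ≠ 0 := by
    rintro rfl
    rcases semilinearPoly_natDegree hp c m with ⟨h, -⟩ | h
    · obtain ⟨j, hj, hne⟩ := hc
      exact hne (h j hj)
    · rw [hG] at h; simp at h; omega
  have hdeg : (Polynomial.X * G - 1).degree ≠ 0 := by
    rw [sub_eq_add_neg, ← Polynomial.C_1, ← Polynomial.C_neg, Polynomial.degree_add_C]
    · rw [Polynomial.degree_mul, Polynomial.degree_X, Polynomial.degree_eq_natDegree hG0]
      norm_cast; omega
    · rw [Polynomial.degree_mul, Polynomial.degree_X, Polynomial.degree_eq_natDegree hG0]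
      norm_cast; omega
  obtain ⟨t, ht⟩ := IsAlgClosed.exists_root _ hdeg
  have ht' : t * G.eval t = 1 := by simpa [Polynomial.IsRoot, sub_eq_zero] using ht
  refine ⟨t, fun h => by simp [h] at ht', ?_⟩
  rw [hG]
  simp only [Polynomial.eval_mul, Polynomial.eval_pow, Polynomial.eval_X]
  linear_combination t * ht'

/-! ### Jacobson's formula, derived series and commuting elements -/

section PMapLemmas

variable {p : ℕ} {F L : Type*} [Field F] [LieRing L] [LieAlgebra F L]

theorem jacobsonCoeff_succ_of_commute {x y : L} (h : ⁅x, y⁆ = 0) (n k : ℕ) :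
    jacobsonCoeff x y (n + 1) k = 0 := by
  have h' : ⁅y, x⁆ = 0 := by rw [← lie_skew, h, neg_zero]
  induction n generalizing k with
  | zero =>
    match k with
    | 0 => simp [jacobsonCoeff, h']
    | 1 => simp [jacobsonCoeff]
    | k + 2 => simp [jacobsonCoeff]
  | succ n ih => cases k <;> rw [jacobsonCoeff] <;> simp [ih]

/-- The first step brackets `X x + y` with `x`; the term `⁅x, x⁆` vanishes and `⁅y, x⁆` lies in the
ideal. -/
theorem jacobsonCoeff_succ_mem (A : LieIdeal F L) (x : L) {y : L} (hy : y ∈ A) (n k : ℕ) :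
    jacobsonCoeff x y (n + 1) k ∈ A := by
  induction n generalizing k with
  | zero =>
    match k with
    | 0 => exact lie_mem_left F L A _ _ hy
    | 1 => simp [jacobsonCoeff]
    | k + 2 => simp [jacobsonCoeff]
  | succ n ih =>
    cases k with
    | zero => exact lie_mem_right F L A _ _ (ih 0)
    | succ k => exact add_mem (lie_mem_right F L A _ _ (ih _)) (lie_mem_right F L A _ _ (ih _))

theorem mem_of_mem_derivedSeries_succ {N : Submodule F L} {k : ℕ}
    (h : ∀ x ∈ LieAlgebra.derivedSeries F L k, ∀ y ∈ LieAlgebra.derivedSeries F L k, ⁅x, y⁆ ∈ N)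
    {x : L} (hx : x ∈ LieAlgebra.derivedSeries F L (k + 1)) : x ∈ N := by
  rw [LieAlgebra.derivedSeries_def, LieAlgebra.derivedSeriesOfIdeal_succ, ← LieSubmodule.mem_toSubmodule,
    LieSubmodule.lieIdeal_oper_eq_linear_span'] at hx
  refine Submodule.span_le.2 ?_ hx
  rintro _ ⟨x, hx, y, hy, rfl⟩
  exact h x hx y hy

/-- `L` acts on the line through scalars, which commute. -/
theorem derivedSeries_one_lie_eq_zero {a : L} (ha : ∀ x : L, ⁅x, a⁆ ∈ Submodule.span F {a}) {x : L}
    (hx : x ∈ LieAlgebra.derivedSeries F L 1) : ⁅x, a⁆ = 0 := by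
  have h := mem_of_mem_derivedSeries_succ (N := LinearMap.ker (LieAlgebra.ad F L a)) (k := 0) (by
    intro x _ y _
    obtain ⟨r, hr⟩ := Submodule.mem_span_singleton.1 (ha x)
    obtain ⟨q, hq⟩ := Submodule.mem_span_singleton.1 (ha y)
    rw [LinearMap.mem_ker, LieAlgebra.ad_apply, ← lie_skew, lie_lie, ← hr, ← hq, lie_smul,
      lie_smul, ← hr, ← hq, smul_comm, sub_self, neg_zero]) hx
  rw [LinearMap.mem_ker, LieAlgebra.ad_apply] at h
  rw [← lie_skew, h, neg_zero]

namespace PMap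

variable (P : PMap p F L)

theorem ad_iterate (x : L) (n : ℕ) :
    LieAlgebra.ad F L (P.toFun^[n] x) = LieAlgebra.ad F L x ^ p ^ n := by
  induction n with
  | zero => simp
  | succ n ih => rw [Function.iterate_succ_apply', P.ad_toFun, ih, pow_succ, pow_mul]

theorem IsRestricted.iterate_mem {P : PMap p F L} {K : LieSubalgebra F L} (hK : P.IsRestricted K)
    {x : L} (hx : x ∈ K) (n : ℕ) : P.toFun^[n] x ∈ K := by
  induction n with
  | zero => exact hx
  | succ n ih => rw [Function.iterate_succ_apply']; exact hK _ ih

theorem lie_eq_zero_of_mem_span {s : Set L} (hs : ∀ x ∈ s, ∀ y ∈ s, ⁅x, y⁆ = 0) {x y : L}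
    (hx : x ∈ Submodule.span F s) (hy : y ∈ Submodule.span F s) : ⁅x, y⁆ = 0 := by
  induction hx, hy using Submodule.span_induction₂ with
  | mem_mem x y hx hy => exact hs x hx y hy
  | zero_left y _ => simp
  | zero_right x _ => simp
  | add_left x y z _ _ _ h1 h2 => simp [h1, h2]
  | add_right x y z _ _ _ h1 h2 => simp [h1, h2]
  | smul_left r x y _ _ h => simp [h]
  | smul_right r x y _ _ h => simp [h]

/-- The span of a set of pairwise commuting elements, as a subalgebra. -/
def spanOfCommute (s : Set L) (hs : ∀ x ∈ s, ∀ y ∈ s, ⁅x, y⁆ = 0) : LieSubalgebra F L :=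
  { Submodule.span F s with
    lie_mem' := fun {x y} hx hy => by
      have : ⁅x, y⁆ = 0 := lie_eq_zero_of_mem_span (F := F) hs hx hy
      rw [this]
      exact (Submodule.span F s).zero_mem }

theorem mem_spanOfCommute {s : Set L} {hs : ∀ x ∈ s, ∀ y ∈ s, ⁅x, y⁆ = 0} {x : L} :
    x ∈ spanOfCommute (F := F) s hs ↔ x ∈ Submodule.span F s := Iff.rfl

theorem IsDuallyAtomistic.exists_maximal {P : PMap p F L} (hP : P.IsDuallyAtomistic)
    {K : LieSubalgebra F L} (hK : P.IsRestricted K) {x : L} (hx : x ∉ K) :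
    ∃ M, P.IsMaximalRestricted M ∧ K ≤ M ∧ x ∉ M := by
  obtain ⟨S, hS, rfl⟩ := hP K hK
  by_contra! h
  rw [← SetLike.mem_coe, LieSubalgebra.coe_sInf] at hx
  exact hx (Set.mem_iInter₂.2 fun M hM => h M (hS M hM) (sInf_le hM))

/-- The ideal spanned by a common eigenvector. -/
def spanIdeal (a : L) (ha : ∀ x : L, ⁅x, a⁆ ∈ Submodule.span F {a}) : LieIdeal F L :=
  { Submodule.span F {a} with
    lie_mem := by
      intro x m hm
      obtain ⟨r, rfl⟩ := Submodule.mem_span_singleton.1 hm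
      rw [lie_smul]
      exact Submodule.smul_mem _ _ (ha x) }

theorem exists_sub_one_eq_succ (p : ℕ) [Fact p.Prime] : ∃ q, p - 1 = q + 1 :=
  ⟨p - 2, by have := (Fact.out : p.Prime).two_le; omega⟩

variable [Fact p.Prime]

theorem map_zero : P.toFun 0 = 0 := by
  have := P.toFun_smul 0 0
  rwa [zero_smul, zero_pow (Fact.out : p.Prime).ne_zero, zero_smul] at this

theorem map_add_of_commute {x y : L} (h : ⁅x, y⁆ = 0) :
    P.toFun (x + y) = P.toFun x + P.toFun y := by
  obtain ⟨q, hq⟩ := exists_sub_one_eq_succ p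
  rw [P.toFun_add, add_eq_left]
  refine Finset.sum_eq_zero fun i _ => ?_
  rw [jacobsonS, hq, jacobsonCoeff_succ_of_commute h, smul_zero]

theorem map_sum_of_commute (x : ℕ → L) (h : ∀ i j, ⁅x i, x j⁆ = 0) (y : ℕ → F) (n : ℕ) :
    P.toFun (∑ i ∈ Finset.range n, y i • x i) =
      ∑ i ∈ Finset.range n, y i ^ p • P.toFun (x i) := by
  induction n with
  | zero => simpa using P.map_zero
  | succ n ih =>
    rw [Finset.sum_range_succ, map_add_of_commute, ih, P.toFun_smul, Finset.sum_range_succ]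
    rw [← lie_skew, lie_sum]; simp [h]

theorem lie_iterate_eq_zero {x y : L} (h : ⁅x, y⁆ = 0) (n : ℕ) : ⁅P.toFun^[n] x, y⁆ = 0 := by
  rw [← LieAlgebra.ad_apply F, ad_iterate]
  obtain ⟨k, hk⟩ := Nat.exists_eq_succ_of_ne_zero
    (pow_ne_zero n (Fact.out : p.Prime).ne_zero)
  rw [hk, pow_succ, Module.End.mul_apply, LieAlgebra.ad_apply, h, LinearMap.map_zero]

theorem lie_iterate_iterate {x y : L} (h : ⁅x, y⁆ = 0) (m n : ℕ) :
    ⁅P.toFun^[m] x, P.toFun^[n] y⁆ = 0 := by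
  apply P.lie_iterate_eq_zero
  rw [← lie_skew, P.lie_iterate_eq_zero, neg_zero]
  rw [← lie_skew, h, neg_zero]

theorem isRestricted_spanOfCommute {s : Set L} (hs : ∀ x ∈ s, ∀ y ∈ s, ⁅x, y⁆ = 0)
    (hP : ∀ x ∈ s, P.toFun x ∈ Submodule.span F s) :
    P.IsRestricted (spanOfCommute (F := F) s hs) := by
  intro x hx
  rw [mem_spanOfCommute] at *
  induction hx using Submodule.span_induction with
  | mem x hx => exact hP x hx
  | zero => rw [P.map_zero]; exact zero_mem _
  | add x y hx hy h1 h2 =>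
    rw [P.map_add_of_commute (lie_eq_zero_of_mem_span (F := F) hs hx hy)]
    exact add_mem h1 h2
  | smul r x _ h => rw [P.toFun_smul]; exact Submodule.smul_mem _ _ h

/-! ### Toral elements -/

theorem exists_toral [IsAlgClosed F] [Module.Finite F L] (x : L) (hx : ∀ n, P.toFun^[n] x ≠ 0) :
    ∃ w ≠ 0, P.toFun w = w ∧ w ∈ Submodule.span F (Set.range fun i => P.toFun^[i] x) := by
  classical
  set v : ℕ → L := fun i => P.toFun^[i] x with hv
  have hsucc : ∀ i, P.toFun (v i) = v (i + 1) := fun i => (Function.iterate_succ_apply' _ _ _).symm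
  -- The least such `n = m + 1` gives `v (m + 1) = ∑ c i • v i` over `i ≤ m`. Comparing
  -- coefficients, `∑ y i • v i` is fixed once `y 0 = c 0 * t ^ p` and `y (i + 1) = y i ^ p + c (i +
  -- 1) * t ^ p` with `t = y m`.
  have hex : ∃ n, v n ∈ Submodule.span F (v '' (Finset.range n : Set ℕ)) := by
    obtain ⟨n, hn⟩ := monotone_stabilizes_iff_noetherian.2 (inferInstance : IsNoetherian F L)
      ⟨fun n => Submodule.span F (v '' (Finset.range n : Set ℕ)), fun i j hij =>
        Submodule.span_mono (Set.image_mono (by simpa using hij))⟩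
    refine ⟨n, ?_⟩
    have hn1 : Submodule.span F (v '' (Finset.range n : Set ℕ)) =
      Submodule.span F (v '' (Finset.range (n + 1) : Set ℕ)) := hn (n + 1) (by omega)
    rw [hn1]
    exact Submodule.subset_span ⟨n, by simp, rfl⟩
  have hn := Nat.find_spec hex
  have hmin := fun m (hm : m < Nat.find hex) => Nat.find_min hex hm
  generalize Nat.find hex = n at hn hmin
  obtain _ | m := n
  · simp at hn; exact absurd hn (hx 0)
  obtain ⟨c, hc⟩ := (Submodule.mem_span_image_finset_iff_exists_fun' F).1 hn
  have hc0 : ∃ j ≤ m, c j ≠ 0 := by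
    by_contra! h
    apply hx (m + 1)
    change v (m + 1) = 0
    rw [← hc]
    exact Finset.sum_eq_zero fun i hi => by rw [h i (by simp at hi; omega), zero_smul]
  obtain ⟨t, ht0, ht⟩ := exists_semilinearPoly_eval_eq_self (Fact.out : p.Prime).two_le c m hc0
  set y : ℕ → F := fun i => (semilinearPoly p c i).eval t with hy
  have hy0 : y 0 = c 0 * t ^ p := by simp [hy, semilinearPoly]
  have hys : ∀ i, y (i + 1) = y i ^ p + c (i + 1) * t ^ p := by simp [hy, semilinearPoly]
  have hym : y m = t := ht
  refine ⟨∑ i ∈ Finset.range (m + 1), y i • v i, fun hw => ?_, ?_, ?_⟩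
  -- A vanishing sum with leading coefficient `t ≠ 0` would put `v m` in the span of its
  -- predecessors.
  · apply hmin m (by omega)
    rw [Finset.sum_range_succ, hym] at hw
    have : v m = (-t⁻¹) • ∑ i ∈ Finset.range m, y i • v i := by
      rw [eq_neg_of_add_eq_zero_left hw, smul_neg, neg_smul, neg_neg, smul_smul,
        inv_mul_cancel₀ ht0, one_smul]
    rw [this]
    refine Submodule.smul_mem _ _ (Submodule.sum_mem _ fun i hi => Submodule.smul_mem _ _ ?_)
    exact Submodule.subset_span ⟨i, hi, rfl⟩
  · rw [P.map_sum_of_commute v (fun i j => P.lie_iterate_iterate (lie_self x) i j),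
      Finset.sum_range_succ, hsucc, hym, ← hc, Finset.sum_range_succ', Finset.sum_range_succ', hy0]
    simp only [hys, hsucc, smul_add, add_smul, Finset.smul_sum, Finset.sum_add_distrib, smul_smul]
    simp only [mul_comm (t ^ p)]
    abel
  · exact Submodule.sum_mem _ fun i _ => Submodule.smul_mem _ _ (Submodule.subset_span ⟨i, rfl⟩)

/-! ### Maximal restricted subalgebras avoiding an ideal -/

theorem map_add_sub_mem {A : LieIdeal F L} (hA : ∀ a ∈ A, P.toFun a ∈ A) (x : L) {a : L}
    (ha : a ∈ A) : P.toFun (x + a) - P.toFun x ∈ A := by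
  obtain ⟨q, hq⟩ := exists_sub_one_eq_succ p
  rw [P.toFun_add, add_assoc, add_sub_cancel_left]
  refine add_mem (hA a ha) (sum_mem fun i _ => ?_)
  rw [jacobsonS, hq]
  exact A.smul_mem _ (jacobsonCoeff_succ_mem A x ha _ _)

/-- `M + A` is restricted, because adding an element of `A` changes the `p`-map only by an element
of `A`; maximality then makes it all of `L`. -/
theorem IsMaximalRestricted.exists_add {P : PMap p F L} {M : LieSubalgebra F L}
    (hM : P.IsMaximalRestricted M) {A : LieIdeal F L} (hA : ∀ a ∈ A, P.toFun a ∈ A) {b : L}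
    (hb : b ∈ A) (hbM : b ∉ M) (x : L) : ∃ m ∈ M, ∃ a ∈ A, m + a = x := by
  let K : LieSubalgebra F L :=
    { M.toSubmodule ⊔ A.toSubmodule with
      lie_mem' := by
        intro x y hx hy
        obtain ⟨m, hm, a, ha, rfl⟩ := Submodule.mem_sup.1 hx
        obtain ⟨n, hn, c, hc, rfl⟩ := Submodule.mem_sup.1 hy
        refine Submodule.mem_sup.2 ⟨⁅m, n⁆, M.lie_mem hm hn, ⁅m, c⁆ + ⁅a, n + c⁆,
          add_mem (lie_mem_right F L A _ _ hc) (lie_mem_left F L A _ _ ha), ?_⟩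
        simp only [add_lie, lie_add]
        abel }
  have hK : ∀ x, x ∈ K ↔ ∃ m ∈ M, ∃ a ∈ A, m + a = x := fun x => Submodule.mem_sup
  have hMK : M < K := by
    refine lt_of_le_of_ne (fun m hm => (hK m).2 ⟨m, hm, 0, zero_mem _, add_zero m⟩) ?_
    intro h
    exact hbM (h ▸ (hK b).2 ⟨0, zero_mem _, b, hb, zero_add b⟩)
  have hKr : P.IsRestricted K := by
    intro x hx
    obtain ⟨m, hm, a, ha, rfl⟩ := (hK x).1 hx
    exact (hK _).2 ⟨P.toFun m, hM.1 m hm, _, P.map_add_sub_mem hA m ha, by abel⟩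
  rw [← hK, hM.2.2 K hKr hMK]
  trivial

theorem isRestricted_bot : P.IsRestricted (⊥ : LieSubalgebra F L) := by
  intro x hx
  rw [LieSubalgebra.mem_bot] at *
  rw [hx, P.map_zero]

theorem IsMaximalRestricted.exists_add_smul {P : PMap p F L} {M : LieSubalgebra F L}
    (hM : P.IsMaximalRestricted M) {a : L} (ha : ∀ x : L, ⁅x, a⁆ ∈ Submodule.span F {a})
    (hPa : P.toFun a ∈ Submodule.span F {a}) (haM : a ∉ M) (x : L) :
    ∃ m ∈ M, ∃ r : F, x = m + r • a := by
  obtain ⟨m, hm, b, hb, rfl⟩ := hM.exists_add (A := spanIdeal a ha) (b := a) (by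
    intro b hb
    obtain ⟨r, rfl⟩ := Submodule.mem_span_singleton.1 hb
    rw [P.toFun_smul]
    exact Submodule.smul_mem _ _ hPa) (Submodule.mem_span_singleton_self a) haM x
  obtain ⟨r, rfl⟩ := Submodule.mem_span_singleton.1 hb
  exact ⟨m, hm, r, rfl⟩

/-- Elements of the first derived term commute with `a`, so their brackets are unchanged when they
are replaced by their components in `M`. -/
theorem IsMaximalRestricted.derivedSeries_two_le {P : PMap p F L} {M : LieSubalgebra F L}
    (hM : P.IsMaximalRestricted M) {a : L} (ha : ∀ x : L, ⁅x, a⁆ ∈ Submodule.span F {a})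
    (hPa : P.toFun a ∈ Submodule.span F {a}) (haM : a ∉ M) {x : L}
    (hx : x ∈ LieAlgebra.derivedSeries F L 2) : x ∈ M := by
  refine mem_of_mem_derivedSeries_succ (N := M.toSubmodule) (k := 1) ?_ hx
  intro x hx y hy
  have hxa := derivedSeries_one_lie_eq_zero ha hx
  have hya := derivedSeries_one_lie_eq_zero ha hy
  obtain ⟨m, hm, r, rfl⟩ := hM.exists_add_smul ha hPa haM x
  obtain ⟨n, hn, q, rfl⟩ := hM.exists_add_smul ha hPa haM y
  have hma : ⁅m, a⁆ = 0 := by simpa using hxa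
  have han : ⁅a, n⁆ = 0 := by rw [← lie_skew, neg_eq_zero]; simpa using hya
  have : ⁅m + r • a, n + q • a⁆ = ⁅m, n⁆ := by simp [hma, han]
  rw [this]
  exact M.lie_mem hm hn

/-! ### Solvability from a one-dimensional ideal with zero `p`-map -/

theorem IsDuallyAtomistic.lie_eq_zero_of_lie_lie_eq_zero {P : PMap p F L}
    (hP : P.IsDuallyAtomistic) {a : L} (ha0 : a ≠ 0)
    (ha : ∀ x : L, ⁅x, a⁆ ∈ Submodule.span F {a}) (hPa : P.toFun a = 0) {k : L}
    (hk : k ∈ LieAlgebra.derivedSeries F L 2) {x : L} (hx : ⁅k, ⁅k, x⁆⁆ = 0) : ⁅k, x⁆ = 0 := by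
  by_contra hkx
  have hPa' : P.toFun a ∈ Submodule.span F {a} := hPa ▸ zero_mem _
  have hka : ⁅k, a⁆ = 0 := derivedSeries_one_lie_eq_zero ha
    (LieAlgebra.derivedSeriesOfIdeal_antitone _ (by omega : 1 ≤ 2) hk)
  -- Since `(k + a)^[p] = k^[p]`, adjoining `k + a` to `T` spans a restricted subalgebra. Elements
  -- of `T` kill `x`, as they act by powers `p ^ (i + 1) ≥ 2` of `ad k`.
  set T : Set L := Set.range fun i => P.toFun^[i + 1] k with hT
  have hTx : ∀ s ∈ Submodule.span F T, ⁅s, x⁆ = 0 := by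
    intro s hs
    induction hs using Submodule.span_induction with
    | mem s hs =>
      obtain ⟨i, rfl⟩ := hs
      obtain ⟨q, hq⟩ := Nat.exists_eq_add_of_le ((Fact.out : p.Prime).two_le.trans
        (Nat.le_self_pow i.succ_ne_zero p))
      dsimp only
      rw [← LieAlgebra.ad_apply F, P.ad_iterate, hq, add_comm, pow_add, Module.End.mul_apply, sq,
        Module.End.mul_apply, LieAlgebra.ad_apply, LieAlgebra.ad_apply, hx, LinearMap.map_zero]
    | zero => simp
    | add s t _ _ h1 h2 => simp [h1, h2]
    | smul r s _ h => simp [h]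
  have hcomm : ∀ u ∈ insert (k + a) T, ∀ w ∈ insert (k + a) T, ⁅u, w⁆ = 0 := by
    have hTk : ∀ i, ⁅P.toFun^[i + 1] k, k + a⁆ = 0 := fun i => by
      rw [lie_add, P.lie_iterate_eq_zero (lie_self k), P.lie_iterate_eq_zero hka, add_zero]
    rintro u (rfl | ⟨i, rfl⟩) w (rfl | ⟨j, rfl⟩)
    · exact lie_self _
    · rw [← lie_skew, hTk, neg_zero]
    · exact hTk i
    · exact P.lie_iterate_iterate (lie_self k) _ _
  have hKr := P.isRestricted_spanOfCommute (F := F) hcomm (by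
    rintro u (rfl | ⟨i, rfl⟩) <;> refine Submodule.subset_span (Set.mem_insert_of_mem _ ?_)
    · rw [P.map_add_of_commute hka, hPa, add_zero]
      exact ⟨0, rfl⟩
    · exact ⟨i + 1, (Function.iterate_succ_apply' _ _ _)⟩)
  by_cases haK : a ∈ spanOfCommute (F := F) _ hcomm
  · obtain ⟨M, hM, -, haM⟩ := hP.exists_maximal P.isRestricted_bot (x := a)
      (by rwa [LieSubalgebra.mem_bot])
    have hkM := hM.derivedSeries_two_le ha hPa' haM hk
    obtain ⟨r, s, hs, has⟩ := Submodule.mem_span_insert.1 haK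
    have hsM : s ∈ M.toSubmodule := by
      refine (Submodule.span_le (p := M.toSubmodule)).2 ?_ hs
      rintro _ ⟨i, rfl⟩
      exact hM.1.iterate_mem hkM _
    -- Both `k` and `s` lie in `M` while `a` does not, so `r = 1` and `k = -s`, which kills `x`.
    have h1 : (1 - r) • a = r • k + s := by
      rw [sub_smul, one_smul, sub_eq_iff_eq_add]
      nth_rw 1 [has]
      rw [smul_add]; abel
    rcases eq_or_ne r 1 with rfl | hr
    · rw [sub_self, zero_smul, one_smul] at h1
      rw [eq_neg_of_add_eq_zero_left h1.symm, neg_lie, hTx s hs, neg_zero] at hkx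
      exact hkx rfl
    · apply haM
      have h2 : (1 - r) • a ∈ M.toSubmodule := by
        rw [h1]; exact add_mem (M.smul_mem _ hkM) hsM
      exact (Submodule.smul_mem_iff _ (sub_ne_zero.2 hr.symm)).1 h2
  · obtain ⟨M, hM, hKM, haM⟩ := hP.exists_maximal hKr haK
    have hkM := hM.derivedSeries_two_le ha hPa' haM hk
    have hkaM : k + a ∈ M := hKM (Submodule.subset_span (Set.mem_insert _ _))
    exact haM ((add_mem_cancel_left hkM).1 hkaM)

theorem IsDuallyAtomistic.isSolvable_of_eigenvector [IsAlgClosed F] [Module.Finite F L]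
    {P : PMap p F L} (hP : P.IsDuallyAtomistic) {a : L} (ha0 : a ≠ 0)
    (ha : ∀ x : L, ⁅x, a⁆ ∈ Submodule.span F {a}) (hPa : P.toFun a = 0) :
    LieAlgebra.IsSolvable L := by
  have key := fun {k : L} (hk : k ∈ LieAlgebra.derivedSeries F L 2) {x : L} =>
    hP.lie_eq_zero_of_lie_lie_eq_zero ha0 ha hPa hk (x := x)
  have had : ∀ k ∈ LieAlgebra.derivedSeries F L 2, LieAlgebra.ad F L k = 0 := by
    intro k hk
    refine Module.End.eq_zero_of_ker_sq_of_eigenvectors _ (fun v hv => key hk hv) ?_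
    intro μ y hy
    rw [LieAlgebra.ad_apply] at hy ⊢
    rcases eq_or_ne μ 0 with rfl | hμ
    · rw [hy, zero_smul]
    have hyD : y ∈ LieAlgebra.derivedSeries F L 2 := by
      have : y = μ⁻¹ • ⁅k, y⁆ := by rw [hy, smul_smul, inv_mul_cancel₀ hμ, one_smul]
      rw [this]
      exact Submodule.smul_mem (LieAlgebra.derivedSeries F L 2).toSubmodule _ (lie_mem_left F L _ _ _ hk)
    -- The roles are exchanged: `⁅y, k⁆` is a multiple of `y`, so `(ad y) ^ 2` kills `k`, and hence
    -- so does `ad y`.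
    rw [← lie_skew, key hyD, neg_zero]
    rw [← lie_skew y k, hy, lie_neg, lie_smul, lie_self, smul_zero, neg_zero]
  refine LieAlgebra.IsSolvable.mk (R := F) (k := 3) ?_
  rw [eq_bot_iff]
  intro x hx
  refine mem_of_mem_derivedSeries_succ (N := (⊥ : Submodule F L)) (k := 2) ?_ hx
  intro x hx y _
  rw [← LieAlgebra.ad_apply F, had x hx]
  simp

/-! ### Solvability from central elements and abelian ideals -/

theorem IsDuallyAtomistic.isSolvable_of_central_toral [IsAlgClosed F] [Module.Finite F L]
    {P : PMap p F L} (hP : P.IsDuallyAtomistic) {z : L} (hz0 : z ≠ 0)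
    (hz : ∀ x : L, ⁅x, z⁆ = 0) (hPz : P.toFun z = z) : LieAlgebra.IsSolvable L := by
  have hz' : ∀ x : L, ⁅x, z⁆ ∈ Submodule.span F {z} := fun x => hz x ▸ zero_mem _
  have hPz' : P.toFun z ∈ Submodule.span F {z} := hPz.symm ▸ Submodule.mem_span_singleton_self z
  have hle : ∀ {M : LieSubalgebra F L}, P.IsMaximalRestricted M → z ∉ M →
      ∀ x ∈ LieAlgebra.derivedSeries F L 1, x ∈ M := by
    intro M hM hzM x hx
    refine mem_of_mem_derivedSeries_succ (N := M.toSubmodule) (k := 0) ?_ hx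
    intro x _ y _
    obtain ⟨m, hm, r, rfl⟩ := hM.exists_add_smul hz' hPz' hzM x
    obtain ⟨n, hn, q, rfl⟩ := hM.exists_add_smul hz' hPz' hzM y
    have hzn : ⁅z, n⁆ = 0 := by rw [← lie_skew, hz, neg_zero]
    have : ⁅m + r • z, n + q • z⁆ = ⁅m, n⁆ := by simp [hz, hzn]
    rw [this]
    exact M.lie_mem hm hn
  have hnil : ∀ k ∈ LieAlgebra.derivedSeries F L 1, ∃ n, P.toFun^[n] k = 0 := by
    intro k hk
    by_contra! hkn
    obtain ⟨w, hw0, hPw, hw⟩ := P.exists_toral k hkn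
    have hwM : ∀ {M : LieSubalgebra F L}, P.IsMaximalRestricted M → z ∉ M → w ∈ M := by
      intro M hM hzM
      refine (Submodule.span_le (p := M.toSubmodule)).2 ?_ hw
      rintro _ ⟨i, rfl⟩
      exact hM.1.iterate_mem (hle hM hzM k hk) i
    have hcomm : ∀ u ∈ ({w + z} : Set L), ∀ v ∈ ({w + z} : Set L), ⁅u, v⁆ = 0 := by
      rintro u rfl v rfl
      exact lie_self _
    have hKr := P.isRestricted_spanOfCommute (F := F) hcomm (by
      rintro u rfl
      rw [P.map_add_of_commute (hz w), hPw, hPz]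
      exact Submodule.mem_span_singleton_self _)
    by_cases hzK : z ∈ spanOfCommute (F := F) _ hcomm
    · obtain ⟨M, hM, -, hzM⟩ := hP.exists_maximal P.isRestricted_bot (x := z)
        (by rwa [LieSubalgebra.mem_bot])
      obtain ⟨r, hr⟩ := Submodule.mem_span_singleton.1 hzK
      have h1 : (1 - r) • z = r • w := by
        rw [sub_smul, one_smul, sub_eq_iff_eq_add, ← smul_add, hr]
      rcases eq_or_ne r 1 with rfl | hr1
      · rw [sub_self, zero_smul, one_smul] at h1
        exact hw0 h1.symm
      · apply hzM
        have h2 : (1 - r) • z ∈ M.toSubmodule := by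
          rw [h1]; exact M.smul_mem _ (hwM hM hzM)
        exact (Submodule.smul_mem_iff _ (sub_ne_zero.2 hr1.symm)).1 h2
    · obtain ⟨M, hM, hKM, hzM⟩ := hP.exists_maximal hKr hzK
      have hwz : w + z ∈ M := hKM (Submodule.mem_span_singleton_self _)
      exact hzM ((add_mem_cancel_left (hwM hM hzM)).1 hwz)
  -- Engel's theorem: if the `n`-th iterate of the `p`-map kills `k`, then `(ad k) ^ (p ^ n) = 0`.
  have hD : LieRing.IsNilpotent (LieAlgebra.derivedSeries F L 1) := by
    rw [LieAlgebra.isNilpotent_iff_forall (R := F)]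
    rintro ⟨k, hk⟩
    obtain ⟨n, hn⟩ := hnil k hk
    refine ⟨p ^ n, ?_⟩
    ext ⟨x, hx⟩
    have hpow : ∀ m, (((LieAlgebra.ad F (LieAlgebra.derivedSeries F L 1) ⟨k, hk⟩) ^ m) ⟨x, hx⟩ : L) =
        (LieAlgebra.ad F L k ^ m) x := by
      intro m
      induction m with
      | zero => rfl
      | succ m ih =>
        rw [pow_succ', pow_succ', Module.End.mul_apply, Module.End.mul_apply, ← ih]
        rfl
    rw [hpow, ← P.ad_iterate, hn]
    simp
  have hDs : LieAlgebra.IsSolvable (LieAlgebra.derivedSeries F L 1) := inferInstance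
  obtain ⟨k, hk⟩ := (LieAlgebra.isSolvable_iff F _).1 hDs
  rw [LieIdeal.derivedSeries_eq_bot_iff, ← LieAlgebra.derivedSeriesOfIdeal_add] at hk
  exact LieAlgebra.IsSolvable.mk hk

/-- If `M` contains `a` but not `⁅x, a⁆`, then `L = M + A`; the `A`-component of `x` commutes with
`a`, so `⁅x, a⁆` lies in `M` after all. -/
theorem IsDuallyAtomistic.lie_mem_span_of_mem_abelian {P : PMap p F L} (hP : P.IsDuallyAtomistic)
    {A : LieIdeal F L} (hA : ∀ a ∈ A, ∀ b ∈ A, ⁅a, b⁆ = 0) (hPA : ∀ a ∈ A, P.toFun a = 0) {a : L}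
    (ha : a ∈ A) (x : L) : ⁅x, a⁆ ∈ Submodule.span F {a} := by
  by_contra hx
  have hcomm : ∀ u ∈ ({a} : Set L), ∀ v ∈ ({a} : Set L), ⁅u, v⁆ = 0 := by
    rintro u rfl v rfl
    exact lie_self _
  have hKr := P.isRestricted_spanOfCommute (F := F) hcomm (by
    rintro u rfl
    rw [hPA u ha]
    exact zero_mem _)
  obtain ⟨M, hM, hKM, hxM⟩ := hP.exists_maximal hKr hx
  have hxA := lie_mem_right F L A x a ha
  obtain ⟨m, hm, b, hb, rfl⟩ :=
    hM.exists_add (fun a ha => (hPA a ha).symm ▸ zero_mem A) hxA hxM x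
  apply hxM
  rw [add_lie, hA b hb a ha, add_zero]
  exact M.lie_mem hm (hKM (Submodule.mem_span_singleton_self a))

theorem IsDuallyAtomistic.isSolvable_of_central [IsAlgClosed F] [Module.Finite F L]
    {P : PMap p F L} (hP : P.IsDuallyAtomistic) {z : L} (hz0 : z ≠ 0)
    (hz : ∀ x : L, ⁅x, z⁆ = 0) : LieAlgebra.IsSolvable L := by
  classical
  have hzi : ∀ n (x : L), ⁅x, P.toFun^[n] z⁆ = 0 := fun n x => by
    rw [← lie_skew, P.lie_iterate_eq_zero, neg_zero]
    rw [← lie_skew, hz, neg_zero]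
  -- The last nonzero iterate is a central eigenvector with zero `p`-map; if no iterate vanishes,
  -- their span contains a central toral element.
  by_cases hn : ∃ n, P.toFun^[n] z = 0
  · have hn0 := Nat.find_spec hn
    obtain ⟨n, h⟩ := Nat.exists_eq_succ_of_ne_zero (n := Nat.find hn)
      (fun h => hz0 (by rwa [h] at hn0))
    rw [h, Nat.succ_eq_add_one, Function.iterate_succ_apply'] at hn0
    exact hP.isSolvable_of_eigenvector (Nat.find_min hn (by omega : n < Nat.find hn))
      (fun x => (hzi n x).symm ▸ zero_mem _) hn0
  · push Not at hn
    obtain ⟨w, hw0, hPw, hw⟩ := P.exists_toral z hn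
    refine hP.isSolvable_of_central_toral hw0 (fun x => ?_) hPw
    change w ∈ Submodule.span F _ at hw
    refine (Submodule.span_le (p := LinearMap.ker (LieAlgebra.ad F L x))).2 ?_ hw
    rintro _ ⟨i, rfl⟩
    exact hzi i x

end PMap

end PMapLemmas

theorem mainTheorem4 (p : ℕ) [Fact p.Prime] (F : Type*) [Field F] [IsAlgClosed F] [CharP F p]
    (L : Type*) [LieRing L] [LieAlgebra F L] [Module.Finite F L]
    (P : PMap p F L) (hP : P.IsDuallyAtomistic) :
    LieAlgebra.IsSolvable L ∨ LieAlgebra.HasTrivialRadical F L := by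
  by_cases hZ : ∃ z : L, z ≠ 0 ∧ ∀ x : L, ⁅x, z⁆ = 0
  · obtain ⟨z, hz0, hz⟩ := hZ
    exact Or.inl (hP.isSolvable_of_central hz0 hz)
  push Not at hZ
  rw [or_iff_not_imp_right, LieAlgebra.hasTrivialRadical_iff_no_abelian_ideals]
  intro h
  push Not at h
  obtain ⟨A, hAab, hA0⟩ := h
  have hA : ∀ a ∈ A, ∀ b ∈ A, ⁅a, b⁆ = 0 := fun a ha b hb =>
    congrArg Subtype.val (trivial_lie_zero A A ⟨a, ha⟩ ⟨b, hb⟩)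
  have hPA : ∀ a ∈ A, P.toFun a = 0 := by
    intro a ha
    by_contra h0
    -- As `A` is an abelian ideal, `(ad a) ^ 2 = 0`; with `p ≥ 2` this makes `a^[p]` central, hence
    -- zero.
    obtain ⟨x, hx⟩ := hZ _ h0
    apply hx
    obtain ⟨q, hq⟩ := Nat.exists_eq_add_of_le (Fact.out : p.Prime).two_le
    rw [← lie_skew, ← LieAlgebra.ad_apply F, P.ad_toFun, hq, add_comm, pow_add,
      Module.End.mul_apply, sq, Module.End.mul_apply, LieAlgebra.ad_apply, LieAlgebra.ad_apply,
      hA a ha _ (lie_mem_left F L A _ _ ha), LinearMap.map_zero, neg_zero]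
  obtain ⟨a, ha, ha0⟩ : ∃ a ∈ A, a ≠ 0 := by
    by_contra! h
    exact hA0 ((LieSubmodule.eq_bot_iff A).2 h)
  exact hP.isSolvable_of_eigenvector ha0 (hP.lie_mem_span_of_mem_abelian hA hPA ha) (hPA a ha)
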